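/- Let $K$ be an infinite field, $n\ge 0$, and let $S=K[x_1,\dots,x_n]$ with its standard grading and $\mathfrak m=(x_1,\dots,x_n)$. For an $S$-module $M$ let $\operatorname{depth}(M)$ be the supremum of the lengths of the $M$-regular sequences with all terms in $\mathfrak m$. For a finitely generated graded $S$-module $M=\bigoplus_{j\ge 0}M_j$ let $H_M(t)=\sum_{j\ge 0}(\dim_K M_j)\,t^j$ be its Hilbert series, and let $$\operatorname{hdepth}(M)=\max\{r : \text{there is a finitely generated graded } S\text{-module } N=\bigoplus_{j\ge 0}N_j \text{ with } H_N(t)=H_M(t) \text{ and } \operatorname{depth}(N)=r\}$$ be its Hilbert depth. Let $I\subsetneq S$ be an ideal generated by squarefree monomials (the zero ideal is allowed), and give $S/I$ the grading induced from $S$. Then $$\operatorname{depth}(S/I)\le \operatorname{hdepth}(S/I)\le \dim(S/I),$$ where $\dim$ denotes Krull dimension, and if moreover $I\neq 0$, then $\dim(S/I)\le n-1$. -/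

import Mathlib

universe u

namespace HilbertDepth

open MvPolynomial

/-- The depth of a module `M` over `K[x_1, …, x_n]` with respect to the ideal
`(x_1, …, x_n)`: the supremum of the lengths of the `M`-regular sequences whose terms lie
in that ideal. -/
noncomputable def depth (K : Type*) [Field K] (n : ℕ) (M : Type*) [AddCommGroup M]
    [Module (MvPolynomial (Fin n) K) M] : ℕ∞ :=
  sSup {r : ℕ∞ | ∃ rs : List (MvPolynomial (Fin n) K),
    (∀ f ∈ rs, f ∈ idealOfVars (Fin n) K) ∧
    RingTheory.Sequence.IsRegular M rs ∧ r = (rs.length : ℕ∞)}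

/-- The family `𝓜` of `K`-subspaces makes `M` a graded module over `K[x_1, …, x_n]` with its
standard grading. -/
structure IsGrading {K : Type*} [Field K] {n : ℕ} {M : Type*} [AddCommGroup M] [Module K M]
    [Module (MvPolynomial (Fin n) K) M] (𝓜 : ℕ → Submodule K M) : Prop where
  isInternal : DirectSum.IsInternal 𝓜
  smul_mem : ∀ (i j : ℕ) (f : MvPolynomial (Fin n) K) (x : M),
    f ∈ homogeneousSubmodule (Fin n) K i → x ∈ 𝓜 j → f • x ∈ 𝓜 (i + j)

/-- The Hilbert series `∑_j (dim_K M_j) t^j` of the graded vector space with components `𝓜 j`. -/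
noncomputable def hilbertSeries {K : Type*} [Field K] {M : Type*} [AddCommGroup M] [Module K M]
    (𝓜 : ℕ → Submodule K M) : PowerSeries ℤ :=
  PowerSeries.mk fun j => (Module.finrank K (𝓜 j) : ℤ)

/-- The Hilbert depth of a graded module over `K[x_1, …, x_n]` with components `𝓜 j`: the largest
depth of a finitely generated graded module `N` with the same Hilbert series. -/
noncomputable def hdepth {K : Type u} [Field K] (n : ℕ) {M : Type*} [AddCommGroup M] [Module K M]
    (𝓜 : ℕ → Submodule K M) : ℕ∞ :=
  sSup {r : ℕ∞ | ∃ (N : Type u) (_ : AddCommGroup N) (_ : Module K N)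
    (_ : Module (MvPolynomial (Fin n) K) N) (_ : IsScalarTower K (MvPolynomial (Fin n) K) N)
    (𝓝 : ℕ → Submodule K N),
    Module.Finite (MvPolynomial (Fin n) K) N ∧ IsGrading (n := n) 𝓝 ∧
    hilbertSeries 𝓝 = hilbertSeries 𝓜 ∧ r = depth K n N}

/-- The degree `j` component of `K[x_1, …, x_n] / I`: the classes of the homogeneous polynomials
of degree `j`. -/
noncomputable def quotientGrading {K : Type*} [Field K] {n : ℕ}
    (I : Ideal (MvPolynomial (Fin n) K)) (j : ℕ) : Submodule K (MvPolynomial (Fin n) K ⧸ I) :=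
  (homogeneousSubmodule (Fin n) K j).map (Ideal.Quotient.mkₐ K I).toLinearMap

/-- `I` is generated by squarefree monomials `x_F = ∏_{i ∈ F} x_i`. -/
def IsSquarefreeMonomialIdeal {K : Type*} [Field K] {n : ℕ}
    (I : Ideal (MvPolynomial (Fin n) K)) : Prop :=
  ∃ A : Set (Finset (Fin n)),
    I = Ideal.span ((fun F : Finset (Fin n) => ∏ i ∈ F, (X i : MvPolynomial (Fin n) K)) '' A)

end HilbertDepth

namespace HilbertDepth

open MvPolynomial

/-! The first inequality holds because `N = S/I` competes in the definition of `hdepth`, and the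
bound `n - 1` because a nonzero element of the domain `S` is a nonzerodivisor. For the middle one,
let `d` be the largest size of a face, a set `F` with `x_F ∉ I`. Then `S/I` surjects onto a
polynomial ring in `d` variables, so `d ≤ dim(S/I)`. A regular sequence of length `r` on `N` is
algebraically independent on some vector, so the summed Hilbert function of `N` grows at least like
`t^r` (`IsGrading.exists_pow_le_sum_finrank`). That of `S/I` is `O(t^d)`, since monomials outside
`I` are supported on faces (`sum_finrank_quotientGrading_le`). The two functions agree, hence `r ≤
d`. -/

theorem aeval_cons_get {K R : Type*} [Field K] [CommRing R] [Algebra K R] (r : R) (rs : List R)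
    (p : MvPolynomial (Fin (r :: rs).length) K) :
    aeval (r :: rs).get p =
      Polynomial.eval₂ (aeval rs.get : MvPolynomial (Fin rs.length) K →ₐ[K] R).toRingHom r
        (finSuccEquiv K rs.length p) := by
  induction p using MvPolynomial.induction_on with
  | C a =>
    simp [finSuccEquiv_apply]
  | add p q hp hq => rw [map_add, map_add, hp, hq, Polynomial.eval₂_add]
  | mul_X p i hp =>
    rw [map_mul, map_mul, hp, Polynomial.eval₂_mul]
    congr 1
    induction i using Fin.cases with
    | zero => rw [finSuccEquiv_X_zero]; simp
    | succ j => rw [finSuccEquiv_X_succ]; simp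

/-- The elements of a regular sequence act algebraically independently on a suitable vector. -/
theorem exists_forall_aeval_smul_eq_zero {K R : Type*} [Field K] [CommRing R] [Algebra K R]
    (rs : List R) {M : Type*} [AddCommGroup M] [Module R M]
    (h : RingTheory.Sequence.IsRegular M rs) :
    ∃ x : M, ∀ p : MvPolynomial (Fin rs.length) K, aeval rs.get p • x = 0 → p = 0 := by
  induction rs generalizing M with
  | nil =>
    have : Nontrivial M := by
      have := h.top_ne_smul
      simp only [Ideal.ofList_nil, Submodule.bot_smul] at this
      exact (Submodule.nontrivial_iff R).mp ⟨⊤, ⊥, this⟩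
    obtain ⟨x, hx⟩ := exists_ne (0 : M)
    refine ⟨x, fun p hp => ?_⟩
    obtain ⟨a, rfl⟩ := C_surjective (R := K) (Fin 0) p
    by_contra ha
    have ha : a ≠ 0 := fun h0 => ha (by rw [h0, map_zero])
    rw [algHom_C] at hp
    apply hx
    rw [← one_smul R x, ← map_one (algebraMap K R), ← inv_mul_cancel₀ ha, map_mul, mul_smul, hp,
      smul_zero]
  | cons r rs ih =>
    rw [RingTheory.Sequence.isRegular_cons_iff] at h
    obtain ⟨y, hy⟩ := ih h.2
    obtain ⟨x, rfl⟩ := Submodule.Quotient.mk_surjective _ y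
    refine ⟨x, fun p hp => ?_⟩
    rw [aeval_cons_get] at hp
    -- Induction on the degree in the variable evaluated at `r`: modulo `r` only the constant
    -- coefficient survives, so it vanishes by the choice of `y`; then one factor `r` cancels, being
    -- regular on `M`.
    suffices H : ∀ (m : ℕ) (P : Polynomial (MvPolynomial (Fin rs.length) K)), P.natDegree ≤ m →
        Polynomial.eval₂ (aeval rs.get : MvPolynomial (Fin rs.length) K →ₐ[K] R).toRingHom r P • x
          = 0 → P = 0 by
      exact (map_eq_zero_iff _ (finSuccEquiv K rs.length).injective).mp (H _ _ le_rfl hp)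
    intro m
    induction m with
    | zero =>
      intro P hP h0
      rw [Polynomial.eq_C_of_natDegree_le_zero hP, Polynomial.eval₂_C] at h0
      have := hy (P.coeff 0) (by
        rw [← Submodule.Quotient.mk_smul]
        exact (congrArg _ h0).trans (Submodule.Quotient.mk_zero _))
      rw [Polynomial.eq_C_of_natDegree_le_zero hP, this, map_zero]
    | succ m ihm =>
      intro P hP h0
      rw [← Polynomial.divX_mul_X_add P, Polynomial.eval₂_add, Polynomial.eval₂_C,
        Polynomial.eval₂_mul, Polynomial.eval₂_X, mul_comm, add_smul, mul_smul] at h0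
      have hc : P.coeff 0 = 0 := hy (P.coeff 0) (by
        rw [← Submodule.Quotient.mk_smul, Submodule.Quotient.mk_eq_zero]
        rw [add_comm, add_eq_zero_iff_eq_neg] at h0
        change (aeval rs.get : MvPolynomial (Fin rs.length) K →ₐ[K] R).toRingHom _ • x ∈ _
        rw [h0]
        exact neg_mem (Submodule.smul_mem_pointwise_smul _ _ _ trivial))
      rw [hc, map_zero, zero_smul, add_zero] at h0
      have hd := ihm P.divX (by rw [Polynomial.natDegree_divX_eq_natDegree_tsub_one]; omega)
        (h.1 (h0.trans (smul_zero r).symm))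
      rw [← Polynomial.divX_mul_X_add P, hd, hc]
      simp

/-! ### The grading of `S/I` -/

theorem quotientGrading_isGrading {K : Type*} [Field K] {n : ℕ}
    {I : Ideal (MvPolynomial (Fin n) K)}
    (hI : ∀ p ∈ I, ∀ j, homogeneousComponent j p ∈ I) :
    IsGrading (n := n) (quotientGrading I) := by
  classical
  refine ⟨?_, ?_⟩
  -- Homogeneity of `I` lets the degree projections descend to the quotient, where they recover the
  -- summands.
  · let comp (j : ℕ) : (MvPolynomial (Fin n) K ⧸ I) →ₗ[K] (MvPolynomial (Fin n) K ⧸ I) :=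
      (I.restrictScalars K).mapQ (I.restrictScalars K) (homogeneousComponent j)
        (fun p hp => hI p hp j)
    have hcomp (j : ℕ) (p : MvPolynomial (Fin n) K) :
        comp j (Ideal.Quotient.mk I p) = Ideal.Quotient.mk I (homogeneousComponent j p) := rfl
    constructor
    · rw [injective_iff_map_eq_zero]
      intro f hf
      have key (j : ℕ) (f : DirectSum ℕ fun i => quotientGrading I i) :
          comp j (DirectSum.coeAddMonoidHom (quotientGrading I) f) = f j := by
        induction f using DirectSum.induction_on with
        | zero => simp
        | of i x =>
          obtain ⟨x, p, hp, rfl⟩ := x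
          rw [DirectSum.coeAddMonoidHom_of]
          refine (hcomp j p).trans ?_
          rw [homogeneousComponent_of_mem hp]
          by_cases hij : j = i
          · subst hij
            rw [DirectSum.of_eq_same, if_pos rfl]
            rfl
          · rw [DirectSum.of_eq_of_ne _ _ _ hij, if_neg hij, map_zero]
            rfl
        | add f g hf hg => rw [map_add, map_add, hf, hg, DirectSum.add_apply, Submodule.coe_add]
      ext j
      rw [← key, hf, map_zero]
      rfl
    · intro y
      obtain ⟨p, rfl⟩ := Ideal.Quotient.mk_surjective y
      refine ⟨∑ i ∈ Finset.range (p.totalDegree + 1), DirectSum.of (fun i => quotientGrading I i) i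
        ⟨_, homogeneousComponent i p, homogeneousComponent_mem i p, rfl⟩, ?_⟩
      rw [map_sum]
      conv_rhs => rw [← sum_homogeneousComponent p, map_sum]
      exact Finset.sum_congr rfl fun i _ => DirectSum.coeAddMonoidHom_of _ _ _
  · rintro i j f _ hf ⟨p, hp, rfl⟩
    exact ⟨f * p, IsHomogeneous.mul hf hp, rfl⟩

theorem IsSquarefreeMonomialIdeal.homogeneousComponent_mem {K : Type*} [Field K] {n : ℕ}
    {I : Ideal (MvPolynomial (Fin n) K)} (hI : IsSquarefreeMonomialIdeal I)
    (p : MvPolynomial (Fin n) K) (hp : p ∈ I) (j : ℕ) : homogeneousComponent j p ∈ I := by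
  obtain ⟨A, rfl⟩ := hI
  let _ : GradedAlgebra (homogeneousSubmodule (Fin n) K) := gradedAlgebra
  refine homogeneousComponent_mem_of_mem
    (Ideal.homogeneous_span (homogeneousSubmodule (Fin n) K) _ ?_) hp j
  rintro _ ⟨F, -, rfl⟩
  exact ⟨_, IsHomogeneous.prod F _ (fun _ => 1) fun i _ => isHomogeneous_X K i⟩

/-! ### Bounds on the Krull dimension of `S/I` -/

theorem card_le_ringKrullDim {K : Type*} [Field K] {n : ℕ}
    {I : Ideal (MvPolynomial (Fin n) K)} (hI : IsSquarefreeMonomialIdeal I) (F : Finset (Fin n))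
    (hF : ∏ i ∈ F, (X i : MvPolynomial (Fin n) K) ∉ I) :
    ((F.card : ℕ) : WithBot ℕ∞) ≤ ringKrullDim (MvPolynomial (Fin n) K ⧸ I) := by
  classical
  obtain ⟨A, rfl⟩ := hI
  let φ : MvPolynomial (Fin n) K →ₐ[K] MvPolynomial F K :=
    aeval fun i => if h : i ∈ F then X ⟨i, h⟩ else 0
  have hker : ∀ p ∈ Ideal.span ((fun F : Finset (Fin n) =>
      ∏ i ∈ F, (X i : MvPolynomial (Fin n) K)) '' A), φ p = 0 := by
    intro p hp
    refine (Ideal.span_le (I := RingHom.ker φ)).mpr ?_ hp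
    rintro _ ⟨G, hG, rfl⟩
    -- A generator `x_G` with `G ⊆ F` would divide `x_F` and force `x_F ∈ I`.
    have : ¬ G ⊆ F := fun h => hF <| Ideal.mem_of_dvd _ (Finset.prod_dvd_prod_of_subset _ _ _ h)
      (Ideal.subset_span ⟨G, hG, rfl⟩)
    obtain ⟨i, hiG, hiF⟩ := Finset.not_subset.mp this
    simp only [SetLike.mem_coe, RingHom.mem_ker, map_prod]
    exact Finset.prod_eq_zero hiG (by simp [φ, hiF])
  have hsurj : Function.Surjective φ := by
    intro q
    refine ⟨rename (↑) q, ?_⟩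
    simp only [φ, aeval_rename]
    convert aeval_X_left_apply q using 2
    congr 1
    ext1 i
    simp
  have h := ringKrullDim_le_of_surjective (Ideal.Quotient.lift _ φ.toRingHom hker)
    (Ideal.Quotient.lift_surjective_of_surjective _ hker hsurj)
  rw [MvPolynomial.ringKrullDim_of_isNoetherianRing, ringKrullDim_eq_zero_of_field] at h
  simpa using h

theorem ringKrullDim_quotient_le_sub_one {K : Type*} [Field K] {n : ℕ}
    {I : Ideal (MvPolynomial (Fin n) K)} (hI : I ≠ ⊥) :
    ringKrullDim (MvPolynomial (Fin n) K ⧸ I) ≤ ((n - 1 : ℕ) : WithBot ℕ∞) := by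
  obtain ⟨f, hf, hf0⟩ := Submodule.exists_mem_ne_zero_of_ne_bot hI
  have h1 : ringKrullDim (MvPolynomial (Fin n) K ⧸ I) ≤
      ringKrullDim (MvPolynomial (Fin n) K ⧸ Ideal.span {f}) :=
    ringKrullDim_le_of_surjective
      (Ideal.Quotient.factor ((Ideal.span_singleton_le_iff_mem I).mpr hf))
      (Ideal.Quotient.factor_surjective _)
  have h2 := ringKrullDim_quotient_succ_le_of_nonZeroDivisor (mem_nonZeroDivisors_of_ne_zero hf0)
  rw [MvPolynomial.ringKrullDim_of_isNoetherianRing, ringKrullDim_eq_zero_of_field, zero_add,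
    Nat.card_fin] at h2
  refine h1.trans ?_
  generalize ringKrullDim (MvPolynomial (Fin n) K ⧸ Ideal.span {f}) = d at h2
  induction d using WithBot.recBotCoe with
  | bot => exact bot_le
  | coe d =>
    have h3 : d + 1 ≤ (n : ℕ∞) := by exact_mod_cast h2
    have : d ≤ ((n - 1 : ℕ) : ℕ∞) := by
      lift d to ℕ using (fun h => by simp [h] at h3)
      norm_cast at h3 ⊢
      omega
    exact WithBot.coe_le_coe.mpr this


/-! ### Hilbert functions of graded modules -/

theorem exists_projection {K M : Type*} [Field K] [AddCommGroup M] [Module K M]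
    {𝓜 : ℕ → Submodule K M} (h : DirectSum.IsInternal 𝓜) (j : ℕ) :
    ∃ π : M →ₗ[K] M, (∀ x ∈ 𝓜 j, π x = x) ∧ ∀ i, i ≠ j → ∀ x ∈ 𝓜 i, π x = 0 := by
  classical
  let _ := h.chooseDecomposition
  refine ⟨(𝓜 j).subtype ∘ₗ DirectSum.component K ℕ (fun i => 𝓜 i) j ∘ₗ
    (DirectSum.decomposeLinearEquiv 𝓜).toLinearMap, fun x hx => ?_, fun i hi x hx => ?_⟩
  · exact DirectSum.decompose_of_mem_same 𝓜 hx
  · exact DirectSum.decompose_of_mem_ne 𝓜 hx hi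

theorem finrank_partialSups_le {K N : Type*} [Field K] [AddCommGroup N] [Module K N]
    {𝓝 : ℕ → Submodule K N} [∀ j, FiniteDimensional K (𝓝 j)] (J : ℕ) :
    FiniteDimensional K (partialSups 𝓝 J : Submodule K N) ∧
    Module.finrank K (partialSups 𝓝 J : Submodule K N) ≤
      ∑ j ∈ Finset.range (J + 1), Module.finrank K (𝓝 j) := by
  induction J with
  | zero =>
    rw [partialSups_zero]
    exact ⟨inferInstance, by simp⟩
  | succ J ih =>
    obtain ⟨h1, h2⟩ := ih
    rw [partialSups_add_one, Finset.sum_range_succ]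
    exact ⟨inferInstance, (Submodule.finrank_add_le_finrank_add_finrank _ _).trans
      (Nat.add_le_add_right h2 _)⟩

section Graded

variable {K : Type*} [Field K] {n : ℕ} {N : Type*} [AddCommGroup N] [Module K N]
  [Module (MvPolynomial (Fin n) K) N] [IsScalarTower K (MvPolynomial (Fin n) K) N]
  {𝓝 : ℕ → Submodule K N}

/-- Degrees are nonnegative, so a form of degree above `j` times any vector has no component in
degree `j`. Only the finitely many spaces `S_i g`, with `i ≤ j` and `g` a generator, contribute; `g`
need not be homogeneous. -/
theorem IsGrading.finiteDimensional [Module.Finite (MvPolynomial (Fin n) K) N]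
    (h𝓝 : IsGrading (n := n) 𝓝) (j : ℕ) : FiniteDimensional K (𝓝 j) := by
  classical
  obtain ⟨π, hπ, hπ'⟩ := exists_projection h𝓝.isInternal j
  obtain ⟨s, hs⟩ := Module.Finite.fg_top (R := MvPolynomial (Fin n) K) (M := N)
  let ψ (g : N) : MvPolynomial (Fin n) K →ₗ[K] N :=
    π ∘ₗ (LinearMap.toSpanSingleton (MvPolynomial (Fin n) K) N g).restrictScalars K
  have hψ (g : N) (f : MvPolynomial (Fin n) K) : ψ g f = π (f • g) := rfl
  have hvanish (g : N) (k : ℕ) (hk : j < k) (f : MvPolynomial (Fin n) K)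
      (hf : f ∈ homogeneousSubmodule (Fin n) K k) : π (f • g) = 0 := by
    have hg : g ∈ ⨆ i, 𝓝 i := by
      rw [h𝓝.isInternal.submodule_iSup_eq_top]; trivial
    induction hg using Submodule.iSup_induction' with
    | mem i x hx => exact hπ' (k + i) (by omega) _ (h𝓝.smul_mem k i f x hf hx)
    | zero => rw [smul_zero, map_zero]
    | add x y _ _ hx hy => rw [smul_add, map_add, hx, hy, add_zero]
  let W (i : ℕ) (g : N) : Submodule K N := (homogeneousSubmodule (Fin n) K i).map (ψ g)
  have hW (i : ℕ) (g : N) : FiniteDimensional K (W i g) := by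
    have : FiniteDimensional K (homogeneousSubmodule (Fin n) K i) :=
      Module.Finite.iff_fg.mpr (homogeneousSubmodule_fg _ _ i)
    infer_instance
  let V : Submodule K N := ⨆ g : s, ⨆ i : Fin (j + 1), W i g
  have hV : FiniteDimensional K V := inferInstance
  have hmem (z : N) : π z ∈ V := by
    have hz : z ∈ Submodule.span (MvPolynomial (Fin n) K) (s : Set N) := by rw [hs]; trivial
    obtain ⟨c, -, rfl⟩ := Submodule.mem_span_finset.mp hz
    rw [map_sum]
    refine sum_mem fun g hg => ?_
    rw [← sum_homogeneousComponent (c g), Finset.sum_smul, map_sum]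
    refine sum_mem fun i _ => ?_
    rcases lt_or_ge j i with hji | hij
    · rw [hvanish g i hji _ (MvPolynomial.homogeneousComponent_mem i _)]
      exact zero_mem _
    · exact Submodule.mem_iSup_of_mem ⟨g, hg⟩ (Submodule.mem_iSup_of_mem
        (⟨i, Nat.lt_succ_of_le hij⟩ : Fin (j + 1))
        ⟨_, MvPolynomial.homogeneousComponent_mem i (c g), hψ g _⟩)
  refine Submodule.finiteDimensional_of_le (S₂ := V) fun z hz => ?_
  rw [← hπ z hz]
  exact hmem z

theorem IsGrading.smul_mem_partialSups (h𝓝 : IsGrading (n := n) 𝓝) {a b : ℕ}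
    {f : MvPolynomial (Fin n) K} (hf : f.totalDegree ≤ a) {x : N} (hx : x ∈ partialSups 𝓝 b) :
    f • x ∈ partialSups 𝓝 (a + b) := by
  have : partialSups 𝓝 b ≤ (partialSups 𝓝 (a + b)).comap (Algebra.lsmul K K N f) := by
    refine partialSups_le _ _ _ fun j hj x hx => ?_
    change f • x ∈ partialSups 𝓝 (a + b)
    rw [← sum_homogeneousComponent f, Finset.sum_smul]
    refine sum_mem fun i hi => ?_
    rw [Finset.mem_range] at hi
    exact le_partialSups_of_le 𝓝 (show i + j ≤ a + b by omega)
      (h𝓝.smul_mem i j _ x (homogeneousComponent_mem i f) hx)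
  exact this hx

/-- A regular sequence of length `r` on a graded module forces its Hilbert function to grow at
least like a polynomial of degree `r`, when summed. -/
theorem IsGrading.exists_pow_le_sum_finrank [Module.Finite (MvPolynomial (Fin n) K) N]
    (h𝓝 : IsGrading (n := n) 𝓝) {rs : List (MvPolynomial (Fin n) K)}
    (h : RingTheory.Sequence.IsRegular N rs) :
    ∃ a b : ℕ, ∀ t : ℕ, (t + 1) ^ rs.length ≤
      ∑ j ∈ Finset.range (a * t + b + 1), Module.finrank K (𝓝 j) := by
  classical
  obtain ⟨x, hx⟩ := exists_forall_aeval_smul_eq_zero (K := K) rs h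
  obtain ⟨b, hb⟩ : ∃ b, x ∈ partialSups 𝓝 b := by
    have hg : x ∈ ⨆ i, 𝓝 i := by
      rw [h𝓝.isInternal.submodule_iSup_eq_top]; trivial
    rw [← iSup_partialSups_eq, Submodule.mem_iSup_of_directed _
      (partialSups 𝓝).monotone.directed_le] at hg
    exact hg
  let e (i : Fin rs.length) : ℕ := (rs.get i).totalDegree
  -- Products of powers of the terms with exponents at most `t` have degree at most `(∑ e i) * t`,
  -- and `x` lives in degrees at most `b`.
  refine ⟨∑ i, e i, b, fun t => ?_⟩
  have := h𝓝.finiteDimensional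
  obtain ⟨hfin, hle⟩ := finrank_partialSups_le (𝓝 := 𝓝) ((∑ i, e i) * t + b)
  refine le_trans ?_ hle
  let v (α : Fin rs.length → Fin (t + 1)) : partialSups 𝓝 ((∑ i, e i) * t + b) :=
    ⟨(∏ i, rs.get i ^ (α i : ℕ)) • x, h𝓝.smul_mem_partialSups (by
      refine (totalDegree_finsetProd _ _).trans ?_
      rw [Finset.sum_mul]
      refine Finset.sum_le_sum fun i _ => (totalDegree_pow _ _).trans ?_
      rw [mul_comm]
      exact Nat.mul_le_mul_left _ (by omega)) hb⟩
  have hv : LinearIndependent K v := by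
    apply LinearIndependent.of_comp (partialSups 𝓝 ((∑ i, e i) * t + b)).subtype
    let L : MvPolynomial (Fin rs.length) K →ₗ[K] N :=
      (LinearMap.toSpanSingleton (MvPolynomial (Fin n) K) N x).restrictScalars K ∘ₗ
        (aeval rs.get).toLinearMap
    have hL : LinearMap.ker L = ⊥ := LinearMap.ker_eq_bot'.mpr fun p hp => hx p hp
    let m (α : Fin rs.length → Fin (t + 1)) : Fin rs.length →₀ ℕ :=
      Finsupp.equivFunOnFinite.symm fun i => (α i : ℕ)
    have hm : Function.Injective m := fun α β hαβ => by
      ext i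
      exact DFunLike.congr_fun hαβ i
    have := (((basisMonomials (Fin rs.length) K).linearIndependent.comp m hm).map' L hL)
    have hfun : (partialSups 𝓝 ((∑ i, e i) * t + b)).subtype ∘ v =
        L ∘ basisMonomials (Fin rs.length) K ∘ m := by
      funext α
      change (∏ i, rs.get i ^ (α i : ℕ)) • x = aeval rs.get (basisMonomials _ K (m α)) • x
      rw [coe_basisMonomials, aeval_monomial, map_one, one_mul,
        Finsupp.prod_fintype _ _ fun i => pow_zero _]
      rfl
    rw [hfun]
    exact this
  simpa using hv.fintype_card_le_finrank

end Graded

/-! ### Counting monomials outside `I` -/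

theorem sum_finrank_quotientGrading_le {K : Type*} [Field K] {n : ℕ}
    {I : Ideal (MvPolynomial (Fin n) K)} {d : ℕ}
    (hd : ∀ F : Finset (Fin n), ∏ i ∈ F, (X i : MvPolynomial (Fin n) K) ∉ I → F.card ≤ d)
    (J : ℕ) :
    ∑ j ∈ Finset.range (J + 1), Module.finrank K (quotientGrading I j) ≤
      2 ^ n * (J + 1) ^ d := by
  classical
  let faces : Finset (Finset (Fin n)) :=
    Finset.univ.filter fun F => ∏ i ∈ F, (X i : MvPolynomial (Fin n) K) ∉ I
  -- Exponent vectors supported in a face with entries at most `J`: at most `2 ^ n` faces, each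
  -- giving at most `(J + 1) ^ d` vectors.
  let U : Finset (Fin n → ℕ) :=
    faces.biUnion fun F => Fintype.piFinset fun i => if i ∈ F then Finset.range (J + 1) else {0}
  have hU : U.card ≤ 2 ^ n * (J + 1) ^ d := by
    refine (Finset.card_biUnion_le_card_mul _ _ ((J + 1) ^ d) fun F hF => ?_).trans
      (Nat.mul_le_mul_right _ ?_)
    · rw [Fintype.card_piFinset]
      have : ∀ i, (if i ∈ F then Finset.range (J + 1) else {0} : Finset ℕ).card =
          if i ∈ F then J + 1 else 1 := fun i => by split_ifs <;> simp
      simp only [this, Finset.prod_ite_mem, Finset.univ_inter, Finset.prod_const]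
      exact Nat.pow_le_pow_right (by omega) (hd F (Finset.mem_filter.mp hF).2)
    · exact (Finset.card_le_univ _).trans (by simp)
  refine le_trans ?_ hU
  have hcomp : ∀ j ∈ Finset.range (J + 1), Module.finrank K (quotientGrading I j) ≤
      (U.filter fun m => ∑ i, m i = j).card := by
    intro j hj
    rw [Finset.mem_range] at hj
    let B : Finset (MvPolynomial (Fin n) K ⧸ I) := (U.filter fun m => ∑ i, m i = j).image
      fun m => Ideal.Quotient.mk I (monomial (Finsupp.equivFunOnFinite.symm m) 1)
    have hB : quotientGrading I j ≤ Submodule.span K (B : Set (MvPolynomial (Fin n) K ⧸ I)) := by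
      rintro _ ⟨p, hp, rfl⟩
      change Ideal.Quotient.mk I p ∈ _
      rw [p.as_sum, map_sum]
      refine sum_mem fun m hm => ?_
      have hdeg : ∑ i, m i = j := by
        rw [← Finsupp.degree_eq_sum]
        exact (IsHomogeneous.degree_eq_sum_deg_support hp hm).symm
      have hsm : Ideal.Quotient.mk I (monomial m (coeff m p)) =
          coeff m p • Ideal.Quotient.mk I (monomial m 1) := by
        rw [← mul_one (coeff m p), ← smul_eq_mul, ← smul_monomial, smul_eq_mul, mul_one]
        rfl
      rw [hsm]
      refine Submodule.smul_mem _ _ ?_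
      by_cases hface : ∏ i ∈ m.support, (X i : MvPolynomial (Fin n) K) ∈ I
      · have : monomial m (1 : K) ∈ I := by
          refine Ideal.mem_of_dvd _ ?_ hface
          rw [monomial_eq, map_one, one_mul]
          exact Finset.prod_dvd_prod_of_dvd _ _ fun i hi =>
            dvd_pow_self _ (Finsupp.mem_support_iff.mp hi)
        rw [Ideal.Quotient.eq_zero_iff_mem.mpr this]
        exact zero_mem _
      · refine Submodule.subset_span (Finset.mem_coe.mpr (Finset.mem_image.mpr ⟨m, ?_, ?_⟩))
        · refine Finset.mem_filter.mpr ⟨Finset.mem_biUnion.mpr ⟨m.support,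
            Finset.mem_filter.mpr ⟨Finset.mem_univ _, hface⟩, ?_⟩, hdeg⟩
          rw [Fintype.mem_piFinset]
          intro i
          split_ifs with hi
          · have := Finset.single_le_sum (f := m) (fun i _ => Nat.zero_le _) (Finset.mem_univ i)
            rw [Finset.mem_range]
            omega
          · simpa using hi
        · rw [Finsupp.equivFunOnFinite_symm_coe]
    calc Module.finrank K (quotientGrading I j)
        ≤ Module.finrank K (Submodule.span K (B : Set (MvPolynomial (Fin n) K ⧸ I))) :=
          Submodule.finrank_mono hB
      _ ≤ B.card := finrank_span_finset_le_card B
      _ ≤ _ := Finset.card_image_le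
  refine (Finset.sum_le_sum hcomp).trans ?_
  rw [← Finset.card_biUnion]
  · exact Finset.card_le_card (Finset.biUnion_subset.mpr fun j _ => Finset.filter_subset _ _)
  · intro i _ j _ hij
    exact Finset.disjoint_filter.mpr fun m _ h1 h2 => hij (h1.symm.trans h2)

theorem le_of_forall_pow_le {r d C a b : ℕ}
    (h : ∀ t : ℕ, (t + 1) ^ r ≤ C * (a * t + b + 1) ^ d) : r ≤ d := by
  by_contra! hrd
  -- At `t = D`, the bound `a * D + b + 1 ≤ (a + b + 1) * (D + 1)` makes the right side at most `D *
  -- (D + 1) ^ d`, below `(D + 1) ^ (d + 1)`.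
  set D := C * (a + b + 1) ^ d
  have h1 := h D
  have h2 : C * (a * D + b + 1) ^ d ≤ D * (D + 1) ^ d := by
    rw [mul_assoc C, ← mul_pow]
    gcongr
    nlinarith
  have h3 : (D + 1) * (D + 1) ^ d ≤ (D + 1) ^ r := by
    rw [← pow_succ']
    exact Nat.pow_le_pow_right (by omega) hrd
  have h4 : 0 < (D + 1) ^ d := by positivity
  nlinarith

end HilbertDepth

open HilbertDepth MvPolynomial in
theorem theorem2p3 {K : Type u} [Field K] [Infinite K] (n : ℕ)
    (I : Ideal (MvPolynomial (Fin n) K)) (hI : HilbertDepth.IsSquarefreeMonomialIdeal I)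
    (hproper : I ≠ ⊤) :
    (HilbertDepth.depth K n (MvPolynomial (Fin n) K ⧸ I)
        ≤ HilbertDepth.hdepth n (HilbertDepth.quotientGrading I)) ∧
    ((HilbertDepth.hdepth n (HilbertDepth.quotientGrading I) : WithBot ℕ∞)
        ≤ ringKrullDim (MvPolynomial (Fin n) K ⧸ I)) ∧
    (I ≠ ⊥ → ringKrullDim (MvPolynomial (Fin n) K ⧸ I) ≤ ((n - 1 : ℕ) : WithBot ℕ∞)) := by
  classical
  refine ⟨?_, ?_, ringKrullDim_quotient_le_sub_one⟩
  · exact le_sSup ⟨_, inferInstance, inferInstance, inferInstance, inferInstance,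
      quotientGrading I, inferInstance, quotientGrading_isGrading hI.homogeneousComponent_mem,
      rfl, rfl⟩
  -- A face of maximal size; `∅` is a face because `I` is proper.
  · obtain ⟨F, hF, hmax⟩ := (Finset.univ.filter fun F : Finset (Fin n) =>
      ∏ i ∈ F, (X i : MvPolynomial (Fin n) K) ∉ I).exists_max_image Finset.card
      ⟨∅, by simpa using (Ideal.ne_top_iff_one I).mp hproper⟩
    refine le_trans ?_ (card_le_ringKrullDim hI F (Finset.mem_filter.mp hF).2)
    refine WithBot.coe_le_coe.mpr (sSup_le ?_)
    rintro _ ⟨N, _, _, _, _, 𝓝, hfin, h𝓝, hser, rfl⟩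
    refine sSup_le ?_
    rintro _ ⟨rs, -, hrs, rfl⟩
    obtain ⟨a, b, hab⟩ := h𝓝.exists_pow_le_sum_finrank hrs
    have hH (j : ℕ) : Module.finrank K (𝓝 j) = Module.finrank K (quotientGrading I j) := by
      have := congrArg (PowerSeries.coeff j) hser
      simpa [hilbertSeries] using this
    simp only [hH] at hab
    exact Nat.cast_le.mpr (le_of_forall_pow_le fun t => (hab t).trans
      (sum_finrank_quotientGrading_le
        (fun G hG => hmax G (Finset.mem_filter.mpr ⟨Finset.mem_univ _, hG⟩)) _))
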